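/- Let $\Omega\subset\mathbb R^3$ be a bounded domain (nonempty connected open set) with smooth boundary. Let $L>0$, $k\in(-1,-\tfrac13)$ and $\beta\in[1,k+\tfrac83)$. Then there exists a constant $C=C(L,k,\beta)>0$ (which may also depend on the fixed domain $\Omega$) such that $$\int_\Omega \varphi^{\beta}\psi\;\le\;\int_\Omega \varphi^{k}\psi\,|\nabla\varphi|^2+\int_\Omega \varphi\,\frac{|\nabla\psi|^4}{\psi^3}+C\int_\Omega\varphi\psi$$ holds for all $\varphi,\psi\in C^1(\overline\Omega)$ with $\varphi>0$ and $\psi>0$ in $\overline\Omega$ and $\int_\Omega\varphi\le L$. -/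

import Mathlib

open scoped ContDiff Gradient

/-- The boundary of `Ω ⊆ ℝ³` is smooth: near every boundary point, after reorienting the axes by a
linear isometry `e`, the set `Ω` is exactly the region strictly above the graph of a `C^∞`
function `γ` of the first two coordinates. -/
def HasSmoothBoundary (Ω : Set (EuclideanSpace ℝ (Fin 3))) : Prop :=
  ∀ x₀ ∈ frontier Ω, ∃ r : ℝ, 0 < r ∧
    ∃ (e : EuclideanSpace ℝ (Fin 3) ≃ₗᵢ[ℝ] EuclideanSpace ℝ (Fin 3))
      (γ : EuclideanSpace ℝ (Fin 2) → ℝ),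
      ContDiff ℝ ∞ γ ∧
        ∀ x ∈ Metric.ball x₀ r, x ∈ Ω ↔ γ !₂[e x 0, e x 1] < e x 2

/-- A smoothly bounded domain of `ℝ³`: a (nonempty) connected, bounded open set with smooth
boundary. -/
structure IsSmoothlyBoundedDomain (Ω : Set (EuclideanSpace ℝ (Fin 3))) : Prop where
  isOpen : IsOpen Ω
  isConnected : IsConnected Ω
  isBounded : Bornology.IsBounded Ω
  hasSmoothBoundary : HasSmoothBoundary Ω

/-- `f ∈ C¹(closure Ω)`, for an open set `Ω`: `f` is continuous on `closure Ω`, continuously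
differentiable in `Ω`, and its gradient extends continuously from `Ω` to `closure Ω`. The values
of `f` outside of `closure Ω` play no role. -/
def IsC1UpToBoundary (Ω : Set (EuclideanSpace ℝ (Fin 3))) (f : EuclideanSpace ℝ (Fin 3) → ℝ) :
    Prop :=
  ContinuousOn f (closure Ω) ∧ ContDiffOn ℝ 1 f Ω ∧
    ∃ G : EuclideanSpace ℝ (Fin 3) → EuclideanSpace ℝ (Fin 3),
      ContinuousOn G (closure Ω) ∧ ∀ x ∈ Ω, ∇ f x = G x

/-! Put `w = φ^((k+2)/2) ψ^(1/2)`. The choice of powers makes `|∇w|²` at most twice the first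
integrand on the right, plus the second, plus a multiple of `φ^(2k+3) ψ`. The embedding of `W^{1,2}`
into `L^6` then bounds `∫ φ^(3k+6) ψ³` by the cube of a multiple of these terms and `∫ w²`.

Weighted AM-GM interpolates `φ^b ψ` between `φ^(3k+6) ψ³`, `φ` and `φψ`, with weights `θ`, `2θ`, `1
- 3θ`. Dividing the first by `T²` and multiplying the second by `T`, for `T` the Sobolev bound,
makes both integrals linear in `T`, as `∫ φ ≤ L`. The last weight is positive exactly when `b < k +
8/3`; it lets the coefficient of `T` be as small as needed, so `∫ φ^b ψ` can be absorbed.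

The Sobolev inequality needs no extension operator: inside `Ω` every point starts short segments in
three independent directions, so a Loomis–Whitney argument gives `W^{1,1} → L^{3/2}`, and applying
this to `w⁴` gives `L^6`. -/

section

open MeasureTheory Set Filter Topology ENNReal

/-! ### Geometry: segments staying in the domain -/

/-- Near every point of `closure Ω` there are linearly independent directions in which one can
travel a fixed distance without leaving `Ω`. -/
def HasInwardSegments (Ω : Set (EuclideanSpace ℝ (Fin 3))) : Prop :=
  ∀ x ∈ closure Ω, ∃ U ∈ 𝓝 x, ∃ b : Module.Basis (Fin 3) ℝ (EuclideanSpace ℝ (Fin 3)),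
    ∃ s : ℝ, 0 < s ∧ ∀ y ∈ Ω ∩ U, ∀ i, ∀ t ∈ Icc 0 s, y + t • b i ∈ Ω

lemma norm_vec_two_le (a b : ℝ) : ‖(!₂[a, b] : EuclideanSpace ℝ (Fin 2))‖ ≤ |a| + |b| := by
  rw [EuclideanSpace.norm_eq]
  apply Real.sqrt_le_iff.2
  refine ⟨by positivity, ?_⟩
  simp only [Fin.sum_univ_two]
  simp
  nlinarith [sq_abs a, sq_abs b, mul_nonneg (abs_nonneg a) (abs_nonneg b)]

/-- Directions close enough to vertical climb faster than a Lipschitz graph; three slightly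
different tilts are already independent. -/
lemma exists_basis_of_tilt (e : EuclideanSpace ℝ (Fin 3) ≃ₗᵢ[ℝ] EuclideanSpace ℝ (Fin 3))
    {δ : ℝ} (hδ : 0 < δ) :
    ∃ b : Module.Basis (Fin 3) ℝ (EuclideanSpace ℝ (Fin 3)),
      ∀ i, |e (b i) 0| + |e (b i) 1| ≤ δ ∧ e (b i) 2 = 1 := by
  let w : Fin 3 → EuclideanSpace ℝ (Fin 3) := ![!₂[δ, 0, 1], !₂[0, δ, 1], !₂[0, 0, 1]]
  have hli : LinearIndependent ℝ (fun i => e.symm (w i)) := by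
    rw [Fintype.linearIndependent_iff]
    intro g hg
    have h := congrArg e hg
    simp only [map_sum, map_smul, LinearIsometryEquiv.apply_symm_apply, map_zero] at h
    have h0 := congrArg (fun v => v 0) h
    have h1 := congrArg (fun v => v 1) h
    have h2 := congrArg (fun v => v 2) h
    simp [w, Fin.sum_univ_three, hδ.ne'] at h0 h1 h2
    intro i
    fin_cases i
    · exact h0
    · exact h1
    · simpa [h0, h1] using h2
  refine ⟨basisOfLinearIndependentOfCardEqFinrank hli (by simp), fun i => ?_⟩
  rw [coe_basisOfLinearIndependentOfCardEqFinrank]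
  fin_cases i <;> simp [w, abs_of_pos hδ, hδ.le]

lemma exists_segments_of_mem_nhds {x : EuclideanSpace ℝ (Fin 3)}
    (b : Module.Basis (Fin 3) ℝ (EuclideanSpace ℝ (Fin 3))) {V : Set (EuclideanSpace ℝ (Fin 3))}
    (hV : V ∈ 𝓝 x) :
    ∃ U ∈ 𝓝 x, ∃ s : ℝ, 0 < s ∧ ∀ y ∈ U, ∀ i, ∀ t ∈ Icc 0 s, y + t • b i ∈ V := by
  have h : ∀ i, ∀ᶠ p : EuclideanSpace ℝ (Fin 3) × ℝ in 𝓝 x ×ˢ 𝓝 0, p.1 + p.2 • b i ∈ V := by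
    intro i
    have hc : Continuous fun p : EuclideanSpace ℝ (Fin 3) × ℝ => p.1 + p.2 • b i := by fun_prop
    rw [← nhds_prod_eq]
    exact hc.continuousAt (by simpa using hV)
  have h' := (eventually_all.2 h)
  rw [Filter.eventually_prod_iff] at h'
  obtain ⟨p, hp, q, hq, hpq⟩ := h'
  obtain ⟨ε, hε, hq⟩ := Metric.eventually_nhds_iff.1 hq
  refine ⟨_, hp, ε / 2, by positivity, fun y hy i t ht => hpq hy (hq ?_) i⟩
  rw [Real.dist_eq, sub_zero, abs_of_nonneg ht.1]
  linarith [ht.2]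

lemma HasSmoothBoundary.hasInwardSegments {Ω : Set (EuclideanSpace ℝ (Fin 3))}
    (hΩ : HasSmoothBoundary Ω) (ho : IsOpen Ω) : HasInwardSegments Ω := by
  intro x hx
  by_cases hxΩ : x ∈ Ω
  · obtain ⟨b, -⟩ := exists_basis_of_tilt (LinearIsometryEquiv.refl ℝ _) one_pos
    obtain ⟨U, hU, s, hs, h⟩ := exists_segments_of_mem_nhds b (ho.mem_nhds hxΩ)
    exact ⟨U, hU, b, s, hs, fun y hy => h y hy.2⟩
  obtain ⟨r, hr, e, γ, hγ, hiff⟩ := hΩ x (by rw [ho.frontier_eq]; exact ⟨hx, hxΩ⟩)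
  obtain ⟨K, W, hW, hL⟩ := (hγ.contDiffAt (x := !₂[e x 0, e x 1])).of_le
    (m := 1) (by exact_mod_cast le_top) |>.exists_lipschitzOnWith
  -- Along such a direction the height gains `t` while the graph rises by at most `K t / (K + 1)`;
  -- the `+ 1` also covers `K = 0`.
  have hδ : (0 : ℝ) < 1 / (K + 1) := by positivity
  obtain ⟨b, hb⟩ := exists_basis_of_tilt e hδ
  have hc : Continuous fun y : EuclideanSpace ℝ (Fin 3) =>
      (!₂[e y 0, e y 1] : EuclideanSpace ℝ (Fin 2)) := by
    refine (PiLp.continuous_toLp 2 _).comp (continuous_pi fun i => ?_)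
    fin_cases i <;> simp <;> fun_prop
  have hV : Metric.ball x r ∩ {y | !₂[e y 0, e y 1] ∈ W} ∈ 𝓝 x :=
    inter_mem (Metric.ball_mem_nhds x hr) (hc.continuousAt hW)
  obtain ⟨U, hU, s, hs, h⟩ := exists_segments_of_mem_nhds b hV
  refine ⟨U, hU, b, s, hs, fun y hy i t ht => ?_⟩
  have hy0 := h y hy.2 i 0 ⟨le_rfl, hs.le⟩
  rw [zero_smul, add_zero] at hy0
  have hyt := h y hy.2 i t ht
  have hyΩ := (hiff y hy0.1).1 hy.1
  rw [hiff _ hyt.1]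
  have hd := hL.dist_le_mul _ hyt.2 _ hy0.2
  have hsub : (!₂[e (y + t • b i) 0, e (y + t • b i) 1] : EuclideanSpace ℝ (Fin 2))
      - !₂[e y 0, e y 1] = !₂[t * e (b i) 0, t * e (b i) 1] := by
    ext j
    fin_cases j <;> simp
  rw [dist_eq_norm, dist_eq_norm, hsub, Real.norm_eq_abs] at hd
  have hn : ‖(!₂[t * e (b i) 0, t * e (b i) 1] : EuclideanSpace ℝ (Fin 2))‖
      ≤ t * (1 / (K + 1)) := by
    refine (norm_vec_two_le _ _).trans ?_
    rw [abs_mul, abs_mul, abs_of_nonneg ht.1, ← mul_add]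
    exact mul_le_mul_of_nonneg_left (hb i).1 ht.1
  have h2 : e (y + t • b i) 2 = e y 2 + t := by simp [(hb i).2]
  rw [h2]
  have hK : (K : ℝ) * (t * (1 / (K + 1))) ≤ t := by
    have : (K : ℝ) * (1 / (K + 1)) ≤ 1 := by
      rw [mul_one_div, div_le_one (by positivity)]
      linarith
    nlinarith [ht.1]
  have := (le_abs_self _).trans (hd.trans ((mul_le_mul_of_nonneg_left hn K.2).trans hK))
  linarith

/-! ### The embedding of `W^{1,1}` into `L^{3/2}` -/

/-- The fundamental theorem of calculus bounds `|u y|` by `|u|` at any point of the segment plus the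
integral of the derivative; integrate this over the segment. -/
lemma ofReal_mul_enorm_le_lintegral_segment {E : Type*} [NormedAddCommGroup E] [NormedSpace ℝ E]
    {Ω : Set E} (ho : IsOpen Ω) {u : E → ℝ} (hu : ContDiffOn ℝ 1 u Ω) {y v : E} {s : ℝ}
    (hseg : ∀ t ∈ Icc 0 s, y + t • v ∈ Ω) :
    ENNReal.ofReal s * ‖u y‖ₑ ≤ ∫⁻ t in Icc 0 s, (‖u (y + t • v)‖ₑ +
      ENNReal.ofReal s * ‖v‖ₑ * ‖fderiv ℝ u (y + t • v)‖ₑ) := by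
  have hline : Continuous fun t : ℝ => y + t • v := by fun_prop
  have hder : ∀ t ∈ Icc 0 s, HasDerivAt (fun t : ℝ => u (y + t • v))
      (fderiv ℝ u (y + t • v) v) t := by
    intro t ht
    have h1 : HasFDerivAt u (fderiv ℝ u (y + t • v)) (y + t • v) :=
      ((hu.contDiffAt (ho.mem_nhds (hseg t ht))).differentiableAt one_ne_zero).hasFDerivAt
    have h2 : HasDerivAt (fun t : ℝ => y + t • v) v t := by
      simpa using ((hasDerivAt_id t).smul_const v).const_add y
    exact h1.comp_hasDerivAt t h2
  have hcf : ContinuousOn (fun t : ℝ => fderiv ℝ u (y + t • v)) (Icc 0 s) :=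
    (hu.continuousOn_fderiv_of_isOpen ho le_rfl).comp hline.continuousOn hseg
  have hcd : ContinuousOn (fun t : ℝ => fderiv ℝ u (y + t • v) v) (Icc 0 s) :=
    hcf.clm_apply continuousOn_const
  have hcu : ContinuousOn (fun t : ℝ => u (y + t • v)) (Icc 0 s) :=
    hu.continuousOn.comp hline.continuousOn hseg
  set J : ℝ≥0∞ := ∫⁻ t in Icc 0 s, ‖v‖ₑ * ‖fderiv ℝ u (y + t • v)‖ₑ with hJ
  have hpt : ∀ t ∈ Icc 0 s, ‖u y‖ₑ ≤ ‖u (y + t • v)‖ₑ + J := by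
    intro t ht
    have hsub : uIcc 0 t ⊆ Icc 0 s := by
      rw [uIcc_of_le ht.1]
      exact Icc_subset_Icc_right ht.2
    have hftc := intervalIntegral.integral_eq_sub_of_hasDerivAt
      (fun r hr => hder r (hsub hr)) ((hcd.mono hsub).intervalIntegrable)
    simp only [zero_smul, add_zero] at hftc
    have hle : ‖u (y + t • v) - u y‖ₑ ≤ J := by
      rw [← hftc, intervalIntegral.integral_of_le ht.1]
      refine (enorm_integral_le_lintegral_enorm _).trans ?_
      refine (lintegral_mono_set (Ioc_subset_Icc_self.trans (Icc_subset_Icc_right ht.2))).trans ?_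
      refine lintegral_mono fun r => ?_
      rw [mul_comm]
      exact ContinuousLinearMap.le_opENorm _ _
    calc ‖u y‖ₑ = ‖u (y + t • v) - (u (y + t • v) - u y)‖ₑ := by congr 1; ring
      _ ≤ ‖u (y + t • v)‖ₑ + ‖u (y + t • v) - u y‖ₑ := enorm_sub_le
      _ ≤ _ := by gcongr
  have hvol : volume (Icc 0 s) = ENNReal.ofReal s := by simp
  calc ENNReal.ofReal s * ‖u y‖ₑ = ∫⁻ _ in Icc 0 s, ‖u y‖ₑ := by
        rw [setLIntegral_const, hvol, mul_comm]
    _ ≤ ∫⁻ t in Icc 0 s, (‖u (y + t • v)‖ₑ + J) := setLIntegral_mono' measurableSet_Icc hpt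
    _ = (∫⁻ t in Icc 0 s, ‖u (y + t • v)‖ₑ) + ENNReal.ofReal s * J := by
        rw [lintegral_add_right _ measurable_const, setLIntegral_const, hvol, mul_comm J]
    _ = _ := by
        rw [lintegral_add_left' (hcu.aemeasurable measurableSet_Icc).enorm, hJ,
          ← lintegral_const_mul' _ _ ENNReal.ofReal_ne_top]
        simp only [mul_assoc]

/-- A Loomis–Whitney type inequality along the directions of a basis of `ℝ³`. -/
lemma exists_setLIntegral_rpow_le_of_le_lintegral_line
    (b : Module.Basis (Fin 3) ℝ (EuclideanSpace ℝ (Fin 3))) :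
    ∃ K : ℝ≥0∞, K ≠ ⊤ ∧ ∀ (B : Set (EuclideanSpace ℝ (Fin 3)))
      (F h : EuclideanSpace ℝ (Fin 3) → ℝ≥0∞), MeasurableSet B → Measurable F →
      (∀ y ∈ B, ∀ i, h y ≤ ∫⁻ t : ℝ, F (y + t • b i)) →
      ∫⁻ y in B, h y ^ (3 / 2 : ℝ) ≤ K * (∫⁻ y, F y) ^ (3 / 2 : ℝ) := by
  let e := b.equivFunL
  let T : (Fin 3 → ℝ) ≃ᵐ EuclideanSpace ℝ (Fin 3) := e.symm.toHomeomorph.toMeasurableEquiv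
  have hTe : ∀ z, T z = e.symm z := fun z => rfl
  let μ : Measure (EuclideanSpace ℝ (Fin 3)) := (volume : Measure (Fin 3 → ℝ)).map e.symm
  have hμ : μ.IsAddHaarMeasure := inferInstance
  -- Lebesgue measure and the coordinate measure of the basis are multiples of each other; `c`
  -- serves to enter the coordinates and `d` to leave them.
  let c := (volume : Measure (EuclideanSpace ℝ (Fin 3))).addHaarScalarFactor μ
  let d := μ.addHaarScalarFactor (volume : Measure (EuclideanSpace ℝ (Fin 3)))
  have hc : (volume : Measure (EuclideanSpace ℝ (Fin 3))) = c • μ :=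
    Measure.isAddLeftInvariant_eq_smul ..
  have hd : μ = d • (volume : Measure (EuclideanSpace ℝ (Fin 3))) :=
    Measure.isAddLeftInvariant_eq_smul ..
  have hline : ∀ (z : Fin 3 → ℝ) (i : Fin 3) (t : ℝ),
      T z + t • b i = T (Function.update z i (t + z i)) := by
    intro z i t
    have h1 : b i = e.symm (Pi.single i 1) := by
      rw [ContinuousLinearEquiv.eq_symm_apply]
      ext j
      simp [e, Pi.single_apply, Finsupp.single_apply, eq_comm]
    rw [hTe, hTe, h1, ← map_smul, ← map_add]
    congr 1
    ext j
    by_cases hj : j = i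
    · subst hj
      simp [add_comm]
    · simp [hj]
  refine ⟨c * (d : ℝ≥0∞) ^ (3 / 2 : ℝ), ENNReal.mul_ne_top coe_ne_top
    (ENNReal.rpow_ne_top_of_nonneg (by norm_num) coe_ne_top), fun B F h hB hF hh => ?_⟩
  have hp : Real.HolderConjugate (Fintype.card (Fin 3) : ℕ) (3 / 2 : ℝ) := by
    rw [Real.holderConjugate_iff]
    norm_num
  have hgrid := lintegral_prod_lintegral_pow_le (fun _ : Fin 3 => (volume : Measure ℝ)) hp
    (hF.comp T.measurable)
  have hmapF : ∫⁻ z, F (T z) = d * ∫⁻ y, F y := by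
    have : ∫⁻ y, F y ∂μ = ∫⁻ z, F (T z) := MeasureTheory.lintegral_map_equiv F T
    rw [← this, hd, lintegral_smul_measure]
    rfl
  calc ∫⁻ y in B, h y ^ (3 / 2 : ℝ)
      ≤ ∫⁻ y in B, ∏ i, (∫⁻ t : ℝ, F (y + t • b i)) ^ (1 / 2 : ℝ) := by
        refine setLIntegral_mono' hB fun y hy => ?_
        calc h y ^ (3 / 2 : ℝ) = ∏ _i : Fin 3, h y ^ (1 / 2 : ℝ) := by
              rw [Finset.prod_const, ← ENNReal.rpow_natCast, ← ENNReal.rpow_mul]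
              norm_num
          _ ≤ _ := Finset.prod_le_prod' fun i _ =>
              ENNReal.rpow_le_rpow (hh y hy i) (by norm_num)
    _ ≤ ∫⁻ y, ∏ i, (∫⁻ t : ℝ, F (y + t • b i)) ^ (1 / 2 : ℝ) := setLIntegral_le_lintegral _ _
    _ = c * ∫⁻ y, ∏ i, (∫⁻ t : ℝ, F (y + t • b i)) ^ (1 / 2 : ℝ) ∂μ := by
        conv_lhs => rw [hc, lintegral_smul_measure]
        rfl
    _ = c * ∫⁻ z, ∏ i, (∫⁻ t : ℝ, F (T z + t • b i)) ^ (1 / 2 : ℝ) := by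
        congr 1
        exact MeasureTheory.lintegral_map_equiv _ T
    _ = c * ∫⁻ z, ∏ i, (∫⁻ t : ℝ, F (T (Function.update z i t))) ^ (1 / 2 : ℝ) := by
        congr 2 with z
        refine Finset.prod_congr rfl fun i _ => ?_
        simp_rw [hline]
        rw [lintegral_add_right_eq_self (fun t => F (T (Function.update z i t))) (z i)]
    _ ≤ c * (∫⁻ z, F (T z)) ^ (3 / 2 : ℝ) := by
        gcongr
        refine le_trans (le_of_eq ?_) hgrid
        norm_num
        rfl
    _ = _ := by
        rw [hmapF, ENNReal.mul_rpow_of_nonneg _ _ (by norm_num), mul_assoc]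

/-- The Sobolev embedding `W^{1,1} → L^{3/2}` on bounded domains of `ℝ³`. -/
lemma HasInwardSegments.exists_lintegral_rpow_le {Ω : Set (EuclideanSpace ℝ (Fin 3))}
    (hΩ : HasInwardSegments Ω) (ho : IsOpen Ω) (hb : Bornology.IsBounded Ω) :
    ∃ K : ℝ≥0∞, K ≠ ⊤ ∧ ∀ u : EuclideanSpace ℝ (Fin 3) → ℝ, ContDiffOn ℝ 1 u Ω →
      ∫⁻ y in Ω, ‖u y‖ₑ ^ (3 / 2 : ℝ) ≤
        K * (∫⁻ y in Ω, (‖u y‖ₑ + ‖fderiv ℝ u y‖ₑ)) ^ (3 / 2 : ℝ) := by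
  -- The closure is compact, so writing `Ω` as `Ω ∩ closure Ω` lets local estimates be glued by
  -- compact induction.
  suffices H : ∃ K : ℝ≥0∞, K ≠ ⊤ ∧ ∀ u : EuclideanSpace ℝ (Fin 3) → ℝ, ContDiffOn ℝ 1 u Ω →
      ∫⁻ y in Ω ∩ closure Ω, ‖u y‖ₑ ^ (3 / 2 : ℝ) ≤
        K * (∫⁻ y in Ω, (‖u y‖ₑ + ‖fderiv ℝ u y‖ₑ)) ^ (3 / 2 : ℝ) by
    rwa [inter_eq_left.2 subset_closure] at H
  refine IsCompact.induction_on (s := closure Ω) (p := fun S => ∃ K : ℝ≥0∞, K ≠ ⊤ ∧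
    ∀ u : EuclideanSpace ℝ (Fin 3) → ℝ, ContDiffOn ℝ 1 u Ω →
      ∫⁻ y in Ω ∩ S, ‖u y‖ₑ ^ (3 / 2 : ℝ) ≤
        K * (∫⁻ y in Ω, (‖u y‖ₑ + ‖fderiv ℝ u y‖ₑ)) ^ (3 / 2 : ℝ)) hb.isCompact_closure
    ⟨0, by simp, by simp⟩ ?_ ?_ ?_
  · rintro S S' hS ⟨K, hK, h⟩
    exact ⟨K, hK, fun u hu => (lintegral_mono_set (inter_subset_inter_right _ hS)).trans (h u hu)⟩
  · rintro S S' ⟨K, hK, h⟩ ⟨K', hK', h'⟩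
    refine ⟨K + K', ENNReal.add_ne_top.2 ⟨hK, hK'⟩, fun u hu => ?_⟩
    rw [inter_union_distrib_left, add_mul]
    exact (lintegral_union_le _ _ _).trans (add_le_add (h u hu) (h' u hu))
  intro x hx
  obtain ⟨U, hU, b, s, hs, hseg⟩ := hΩ x hx
  obtain ⟨V, hVU, hVo, hxV⟩ := mem_nhds_iff.1 hU
  refine ⟨V, mem_nhdsWithin_of_mem_nhds (hVo.mem_nhds hxV), ?_⟩
  obtain ⟨K, hK, hKle⟩ := exists_setLIntegral_rpow_le_of_le_lintegral_line b
  let M : ℝ≥0∞ := (ENNReal.ofReal s)⁻¹ + ∑ i, ‖b i‖ₑ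
  have hs0 : ENNReal.ofReal s ≠ 0 := by simpa using hs
  have hM : M ≠ ⊤ := ENNReal.add_ne_top.2
    ⟨ENNReal.inv_ne_top.2 hs0, (ENNReal.sum_lt_top.2 fun i _ => enorm_lt_top).ne⟩
  refine ⟨K * M ^ (3 / 2 : ℝ), ENNReal.mul_ne_top hK
    (ENNReal.rpow_ne_top_of_nonneg (by norm_num) hM), fun u hu => ?_⟩
  have hg : ContinuousOn (fun y => ‖u y‖ₑ + ‖fderiv ℝ u y‖ₑ) Ω :=
    (hu.continuousOn.enorm).add (hu.continuousOn_fderiv_of_isOpen ho le_rfl).enorm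
  have hgm : Measurable (Ω.indicator fun y => ‖u y‖ₑ + ‖fderiv ℝ u y‖ₑ) := by
    classical
    have := hg.measurable_piecewise (continuousOn_const (c := (0 : ℝ≥0∞))) ho.measurableSet
    exact this
  have key := hKle (Ω ∩ V) (fun y => M * Ω.indicator (fun y => ‖u y‖ₑ + ‖fderiv ℝ u y‖ₑ) y)
    (fun y => ‖u y‖ₑ) (ho.inter hVo).measurableSet (hgm.const_mul M) ?_
  · refine key.trans (le_of_eq ?_)
    rw [lintegral_const_mul _ hgm, lintegral_indicator ho.measurableSet,
      ENNReal.mul_rpow_of_nonneg _ _ (by norm_num), mul_assoc]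
  intro y hy i
  have hseg' := hseg y ⟨hy.1, hVU hy.2⟩ i
  have h1 := ofReal_mul_enorm_le_lintegral_segment ho hu hseg'
  have h2 : ‖u y‖ₑ ≤ (ENNReal.ofReal s)⁻¹ * ∫⁻ t in Icc 0 s, (‖u (y + t • b i)‖ₑ +
      ENNReal.ofReal s * ‖b i‖ₑ * ‖fderiv ℝ u (y + t • b i)‖ₑ) := by
    refine le_trans (le_of_eq ?_) (mul_le_mul_right h1 _)
    rw [← mul_assoc, ENNReal.inv_mul_cancel hs0 ENNReal.ofReal_ne_top, one_mul]
  refine h2.trans ?_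
  rw [← lintegral_const_mul' _ _ (ENNReal.inv_ne_top.2 hs0)]
  refine le_trans (setLIntegral_mono' measurableSet_Icc fun t ht => ?_)
    (setLIntegral_le_lintegral (Icc 0 s) _)
  rw [indicator_of_mem (hseg' t ht), mul_add, mul_add, ← mul_assoc, ← mul_assoc,
    ENNReal.inv_mul_cancel hs0 ENNReal.ofReal_ne_top, one_mul]
  refine add_le_add (mul_le_mul_left le_self_add _) (mul_le_mul_left ?_ _)
  exact (Finset.single_le_sum (f := fun i => ‖b i‖ₑ) (fun _ _ => zero_le)
    (Finset.mem_univ i)).trans le_add_self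

/-! ### The embedding of `W^{1,2}` into `L^6` -/

lemma sq_integral_mul_le {α : Type*} [MeasurableSpace α] {μ : Measure α} {f g : α → ℝ}
    (hf : Integrable (fun x => f x ^ 2) μ) (hg : Integrable (fun x => g x ^ 2) μ)
    (hfg : Integrable (fun x => f x * g x) μ) :
    (∫ x, f x * g x ∂μ) ^ 2 ≤ (∫ x, f x ^ 2 ∂μ) * ∫ x, g x ^ 2 ∂μ := by
  have h : ∀ t : ℝ, 0 ≤ (∫ x, f x ^ 2 ∂μ) * (t * t) + (2 * ∫ x, f x * g x ∂μ) * t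
      + ∫ x, g x ^ 2 ∂μ := by
    intro t
    calc 0 ≤ ∫ x, (t * f x + g x) ^ 2 ∂μ := integral_nonneg fun x => sq_nonneg _
      _ = ∫ x, (t ^ 2 * f x ^ 2 + (2 * t) * (f x * g x) + g x ^ 2) ∂μ := by
          congr 1 with x
          ring
      _ = _ := by
          have hs : Integrable (fun x => t ^ 2 * f x ^ 2 + (2 * t) * (f x * g x)) μ :=
            (hf.const_mul _).add (hfg.const_mul _)
          rw [integral_add hs hg, integral_add (hf.const_mul _) (hfg.const_mul _), integral_const_mul,
            integral_const_mul]
          ring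
  have := discrim_le_zero h
  rw [discrim] at this
  linarith

lemma norm_gradient_eq_norm_fderiv {E : Type*} [NormedAddCommGroup E] [InnerProductSpace ℝ E]
    [CompleteSpace E] (f : E → ℝ) (x : E) : ‖∇ f x‖ = ‖fderiv ℝ f x‖ := by
  rw [← toDual_gradient, LinearIsometryEquiv.norm_map]

lemma ContinuousOn.integrableOn_of_isBounded {Ω : Set (EuclideanSpace ℝ (Fin 3))}
    (hb : Bornology.IsBounded Ω) {f : EuclideanSpace ℝ (Fin 3) → ℝ}
    (hf : ContinuousOn f (closure Ω)) : IntegrableOn f Ω :=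
  (hf.integrableOn_compact hb.isCompact_closure).mono_set subset_closure

/-- The Sobolev embedding `W^{1,2} → L^6` on bounded domains of `ℝ³`. -/
lemma IsSmoothlyBoundedDomain.exists_integral_pow_six_le {Ω : Set (EuclideanSpace ℝ (Fin 3))}
    (hΩ : IsSmoothlyBoundedDomain Ω) :
    ∃ C : ℝ, 0 < C ∧ ∀ w : EuclideanSpace ℝ (Fin 3) → ℝ, IsC1UpToBoundary Ω w →
      ∫ x in Ω, w x ^ 6 ≤ (C * ∫ x in Ω, (‖∇ w x‖ ^ 2 + w x ^ 2)) ^ 3 := by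
  obtain ⟨K, hK, hle⟩ := (hΩ.hasSmoothBoundary.hasInwardSegments
    hΩ.isOpen).exists_lintegral_rpow_le hΩ.isOpen hΩ.isBounded
  refine ⟨17 * (K.toReal ^ 4 + 1), by positivity, ?_⟩
  rintro w ⟨hwc, hwd, G, hGc, hG⟩
  have hm := hΩ.isOpen.measurableSet
  have hY : ContinuousOn (fun x => w x ^ 4 + 4 * |w x| ^ 3 * ‖G x‖) (closure Ω) :=
    (hwc.pow 4).add ((continuousOn_const.mul (hwc.abs.pow 3)).mul hGc.norm)
  have h6 : IntegrableOn (fun x => w x ^ 6) Ω :=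
    (hwc.pow 6).integrableOn_of_isBounded hΩ.isBounded
  have hG2 : ContinuousOn (fun x => (|w x| + 4 * ‖G x‖)) (closure Ω) :=
    hwc.abs.add (continuousOn_const.mul hGc.norm)
  set X := ∫ x in Ω, w x ^ 6 with hX
  set Y := ∫ x in Ω, (w x ^ 4 + 4 * |w x| ^ 3 * ‖G x‖) with hYdef
  set H := ∫ x in Ω, (‖∇ w x‖ ^ 2 + w x ^ 2) with hH
  have hH' : H = ∫ x in Ω, (‖G x‖ ^ 2 + w x ^ 2) :=
    setIntegral_congr_fun hm fun x hx => by simp only [hG x hx]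
  have hX0 : 0 ≤ X := integral_nonneg fun x => by positivity
  have hY0 : 0 ≤ Y := integral_nonneg fun x => by positivity
  have hH0 : 0 ≤ H := integral_nonneg fun x => by positivity
  have hXY : X ≤ K.toReal * Y ^ (3 / 2 : ℝ) := by
    -- The gradient of `w⁴` has size `4 |w|³ |∇w|`, and `(w⁴)^(3/2) = w⁶`.
    have h := hle (fun x => w x ^ 4) (hwd.pow 4)
    have hl : ∫⁻ y in Ω, ‖w y ^ 4‖ₑ ^ (3 / 2 : ℝ) = ENNReal.ofReal X := by
      rw [hX, ofReal_integral_eq_lintegral_ofReal h6 (ae_of_all _ fun x => by positivity)]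
      refine lintegral_congr fun x => ?_
      rw [Real.enorm_of_nonneg (by positivity),
        ENNReal.ofReal_rpow_of_nonneg (by positivity) (by norm_num)]
      congr 1
      have : w x ^ 4 = |w x| ^ (4 : ℝ) := by
        norm_cast
        rw [Even.pow_abs (by decide)]
      rw [this, ← Real.rpow_mul (abs_nonneg _)]
      norm_num
      rw [Even.pow_abs (by decide)]
    have hr : ∫⁻ y in Ω, (‖w y ^ 4‖ₑ + ‖fderiv ℝ (fun x => w x ^ 4) y‖ₑ) =
        ENNReal.ofReal Y := by
      rw [hYdef, ofReal_integral_eq_lintegral_ofReal (hY.integrableOn_of_isBounded hΩ.isBounded)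
        (ae_of_all _ fun x => by positivity)]
      refine setLIntegral_congr_fun hm fun x hx => ?_
      have hdx : DifferentiableAt ℝ w x :=
        (hwd.contDiffAt (hΩ.isOpen.mem_nhds hx)).differentiableAt one_ne_zero
      have hfd : fderiv ℝ (fun x => w x ^ 4) x = (4 * w x ^ 3) • fderiv ℝ w x := by
        simpa using (hdx.hasFDerivAt.pow 4).fderiv
      rw [ENNReal.ofReal_add (by positivity) (by positivity),
        Real.enorm_of_nonneg (by positivity), hfd, ← ofReal_norm, norm_smul,
        ← norm_gradient_eq_norm_fderiv, hG x hx, norm_mul, norm_pow]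
      simp
    rw [hl, hr, ENNReal.ofReal_rpow_of_nonneg hY0 (by norm_num), ← ENNReal.ofReal_toReal hK,
      ← ENNReal.ofReal_mul ENNReal.toReal_nonneg] at h
    exact (ENNReal.ofReal_le_ofReal_iff (by positivity)).1 h
  have hX2 : X ^ 2 ≤ K.toReal ^ 2 * Y ^ 3 := by
    refine (pow_le_pow_left₀ hX0 hXY 2).trans (le_of_eq ?_)
    rw [mul_pow, ← Real.rpow_natCast (Y ^ (3 / 2 : ℝ)), ← Real.rpow_mul hY0]
    norm_num
  -- Cauchy–Schwarz with factors `|w|³` and `|w| + 4 |∇w|`; the constant is `17 = 1² + 4²`.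
  have hY2 : Y ^ 2 ≤ X * (17 * H) := by
    have h3 : ContinuousOn (fun x => |w x| ^ 3) (closure Ω) := hwc.abs.pow 3
    have hcs := sq_integral_mul_le (μ := volume.restrict Ω)
      ((h3.pow 2).integrableOn_of_isBounded hΩ.isBounded)
      ((hG2.pow 2).integrableOn_of_isBounded hΩ.isBounded)
      ((h3.mul hG2).integrableOn_of_isBounded hΩ.isBounded)
    have e1 : Y = ∫ x in Ω, |w x| ^ 3 * (|w x| + 4 * ‖G x‖) := by
      rw [hYdef]
      congr 1 with x
      rw [← Even.pow_abs (show Even 4 by decide) (w x)]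
      ring
    have e2 : X = ∫ x in Ω, (|w x| ^ 3) ^ 2 := by
      rw [hX]
      congr 1 with x
      rw [← Even.pow_abs (show Even 6 by decide) (w x)]
      ring
    rw [← e1, ← e2] at hcs
    refine hcs.trans (mul_le_mul_of_nonneg_left ?_ hX0)
    rw [hH', ← integral_const_mul]
    refine integral_mono ((hG2.pow 2).integrableOn_of_isBounded hΩ.isBounded)
      ((continuousOn_const.mul ((hGc.norm.pow 2).add (hwc.pow 2))).integrableOn_of_isBounded
        hΩ.isBounded) fun x => ?_
    simp only
    nlinarith [sq_nonneg (4 * |w x| - ‖G x‖), sq_abs (w x)]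
  -- Arranged so that the factor `X³` cancels when `X > 0`.
  have hX4 : X ^ 3 * X ≤ X ^ 3 * (K.toReal ^ 4 * (17 * H) ^ 3) :=
    calc X ^ 3 * X = (X ^ 2) ^ 2 := by ring
      _ ≤ (K.toReal ^ 2 * Y ^ 3) ^ 2 := pow_le_pow_left₀ (by positivity) hX2 2
      _ = K.toReal ^ 4 * (Y ^ 2) ^ 3 := by ring
      _ ≤ K.toReal ^ 4 * (X * (17 * H)) ^ 3 := by gcongr
      _ = _ := by ring
  have hk : K.toReal ^ 4 ≤ (K.toReal ^ 4 + 1) ^ 3 := by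
    have : 0 ≤ K.toReal ^ 4 := by positivity
    nlinarith [pow_nonneg this 2, pow_nonneg this 3]
  have hfin : X ≤ K.toReal ^ 4 * (17 * H) ^ 3 := by
    rcases hX0.eq_or_lt with h0 | h0
    · rw [← h0]
      positivity
    · exact le_of_mul_le_mul_left hX4 (by positivity)
  calc X ≤ K.toReal ^ 4 * (17 * H) ^ 3 := hfin
    _ ≤ (K.toReal ^ 4 + 1) ^ 3 * (17 * H) ^ 3 := by gcongr
    _ = _ := by ring

/-! ### Pointwise estimates for the weighted product -/

lemma IsC1UpToBoundary.rpow_mul_rpow {Ω : Set (EuclideanSpace ℝ (Fin 3))} (ho : IsOpen Ω)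
    {φ ψ : EuclideanSpace ℝ (Fin 3) → ℝ} (hφ : IsC1UpToBoundary Ω φ)
    (hψ : IsC1UpToBoundary Ω ψ) (hφ0 : ∀ x ∈ closure Ω, 0 < φ x) (hψ0 : ∀ x ∈ closure Ω, 0 < ψ x)
    (a b : ℝ) :
    IsC1UpToBoundary Ω (fun x => φ x ^ a * ψ x ^ b) ∧ ∀ x ∈ Ω,
      ∇ (fun x => φ x ^ a * ψ x ^ b) x =
        (a * φ x ^ (a - 1) * ψ x ^ b) • ∇ φ x + (b * φ x ^ a * ψ x ^ (b - 1)) • ∇ ψ x := by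
  obtain ⟨hφc, hφd, G, hGc, hG⟩ := hφ
  obtain ⟨hψc, hψd, D, hDc, hD⟩ := hψ
  have hrφ : ∀ c : ℝ, ContinuousOn (fun x => φ x ^ c) (closure Ω) := fun c =>
    hφc.rpow_const fun x hx => Or.inl (hφ0 x hx).ne'
  have hrψ : ∀ c : ℝ, ContinuousOn (fun x => ψ x ^ c) (closure Ω) := fun c =>
    hψc.rpow_const fun x hx => Or.inl (hψ0 x hx).ne'
  have hgrad : ∀ x ∈ Ω, ∇ (fun x => φ x ^ a * ψ x ^ b) x =
        (a * φ x ^ (a - 1) * ψ x ^ b) • ∇ φ x + (b * φ x ^ a * ψ x ^ (b - 1)) • ∇ ψ x := by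
    intro x hx
    have h1 := ((hφd.contDiffAt (ho.mem_nhds hx)).differentiableAt one_ne_zero).hasFDerivAt
    have h2 := ((hψd.contDiffAt (ho.mem_nhds hx)).differentiableAt one_ne_zero).hasFDerivAt
    have h := (h1.rpow_const (p := a) (Or.inl (hφ0 x (subset_closure hx)).ne')).mul
      (h2.rpow_const (p := b) (Or.inl (hψ0 x (subset_closure hx)).ne'))
    refine HasGradientAt.gradient (hasGradientAt_iff_hasFDerivAt.2 ?_)
    refine h.congr_fderiv ?_
    rw [← toDual_gradient, ← toDual_gradient, map_add, map_smulₛₗ, map_smulₛₗ, smul_smul,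
      smul_smul, add_comm]
    simp only [RCLike.conj_to_real]
    congr 2 <;> ring
  refine ⟨⟨(hrφ a).mul (hrψ b), ?_, fun x =>
    (a * φ x ^ (a - 1) * ψ x ^ b) • G x + (b * φ x ^ a * ψ x ^ (b - 1)) • D x, ?_, ?_⟩, hgrad⟩
  · exact (hφd.rpow_const_of_ne fun x hx => (hφ0 x (subset_closure hx)).ne').mul
      (hψd.rpow_const_of_ne fun x hx => (hψ0 x (subset_closure hx)).ne')
  · exact (((continuousOn_const.mul (hrφ _)).mul (hrψ _)).smul hGc).add
      (((continuousOn_const.mul (hrφ _)).mul (hrψ _)).smul hDc)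
  · intro x hx
    rw [hgrad x hx, hG x hx, hD x hx]

lemma rpow_le_rpow_add_self {p c b : ℝ} (hp : 0 < p) (hc : 1 ≤ c) (hcb : c ≤ b) :
    p ^ c ≤ p ^ b + p := by
  rcases le_total p 1 with h | h
  · have h1 := Real.rpow_le_rpow_of_exponent_ge hp h hc
    rw [Real.rpow_one] at h1
    linarith [Real.rpow_nonneg hp.le b]
  · linarith [Real.rpow_le_rpow_of_exponent_le h hcb]

/-- Young's inequality splits `p^(k+2) ‖w‖² / q`, which is `p q` times the product of `p^(k+1)` and
`‖w‖² / q²`. The range of `k` gives `((k+2)/2)² ≤ 1`. -/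
lemma sq_norm_smul_add_smul_le {E : Type*} [NormedAddCommGroup E] [InnerProductSpace ℝ E]
    {p q k : ℝ} (hp : 0 < p) (hq : 0 < q) (hk : k ∈ Ioo (-1 : ℝ) (-(1 / 3))) (v w : E) :
    ‖((k + 2) / 2 * p ^ ((k + 2) / 2 - 1) * q ^ (1 / 2 : ℝ)) • v +
        (1 / 2 * p ^ ((k + 2) / 2) * q ^ (1 / 2 - 1 : ℝ)) • w‖ ^ 2 ≤
      2 * (p ^ k * q * ‖v‖ ^ 2) + p * (‖w‖ ^ 4 / q ^ 3) + 1 / 2 * (p ^ (2 * k + 3) * q) := by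
  have e1 : (p ^ ((k + 2) / 2 - 1)) ^ 2 = p ^ k := by
    rw [← Real.rpow_natCast, ← Real.rpow_mul hp.le]
    congr 1
    push_cast
    ring
  have e2 : (p ^ ((k + 2) / 2)) ^ 2 = p * p ^ (k + 1) := by
    rw [← Real.rpow_natCast, ← Real.rpow_mul hp.le, ← Real.rpow_one_add' hp.le (by linarith [hk.1])]
    congr 1
    push_cast
    ring
  have e3 : (q ^ (1 / 2 : ℝ)) ^ 2 = q := by
    rw [← Real.rpow_natCast, ← Real.rpow_mul hq.le]
    norm_num
  have e4 : (q ^ (1 / 2 - 1 : ℝ)) ^ 2 = q⁻¹ := by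
    rw [← Real.rpow_natCast, ← Real.rpow_mul hq.le, ← Real.rpow_neg_one]
    norm_num
  have e5 : p ^ (2 * k + 3) = p * (p ^ (k + 1)) ^ 2 := by
    rw [← Real.rpow_natCast, ← Real.rpow_mul hp.le, ← Real.rpow_one_add' hp.le
      (by push_cast; linarith [hk.1])]
    congr 1
    push_cast
    ring
  have hk2 : ((k + 2) / 2) ^ 2 ≤ 1 := by nlinarith [hk.1, hk.2]
  set P := p ^ (k + 1) with hP
  have hP0 : 0 < P := Real.rpow_pos_of_pos hp _
  set x := ((k + 2) / 2 * p ^ ((k + 2) / 2 - 1) * q ^ (1 / 2 : ℝ)) • v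
  set y := (1 / 2 * p ^ ((k + 2) / 2) * q ^ (1 / 2 - 1 : ℝ)) • w
  have hx : ‖x‖ ^ 2 = ((k + 2) / 2) ^ 2 * (p ^ k * q * ‖v‖ ^ 2) := by
    rw [norm_smul, mul_pow, Real.norm_eq_abs, sq_abs, mul_pow, mul_pow, e1, e3]
    ring
  have hy : ‖y‖ ^ 2 = 1 / 4 * (p * P * q⁻¹ * ‖w‖ ^ 2) := by
    rw [norm_smul, mul_pow, Real.norm_eq_abs, sq_abs, mul_pow, mul_pow, e2, e4]
    ring
  have hxy : ‖x + y‖ ^ 2 ≤ 2 * ‖x‖ ^ 2 + 2 * ‖y‖ ^ 2 := by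
    have := pow_le_pow_left₀ (norm_nonneg _) (norm_add_le x y) 2
    nlinarith [sq_nonneg (‖x‖ - ‖y‖)]
  have hx' : ‖x‖ ^ 2 ≤ p ^ k * q * ‖v‖ ^ 2 := by
    rw [hx]
    exact mul_le_of_le_one_left (by positivity) hk2
  have hy' : p * P * q⁻¹ * ‖w‖ ^ 2 ≤ p * (‖w‖ ^ 4 / q ^ 3) + p * P ^ 2 * q := by
    set z := ‖w‖ ^ 2 / q ^ 2 with hz
    have hz0 : 0 ≤ z := by positivity
    have e6 : p * P * q⁻¹ * ‖w‖ ^ 2 = p * q * (P * z) := by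
      rw [hz]
      field_simp
    have e7 : p * (‖w‖ ^ 4 / q ^ 3) = p * q * z ^ 2 := by
      rw [hz]
      field_simp
    rw [e6, e7]
    have : P * z ≤ z ^ 2 + P ^ 2 := by nlinarith [sq_nonneg (z - P), mul_nonneg hP0.le hz0]
    nlinarith [mul_le_mul_of_nonneg_left this (mul_pos hp hq).le]
  have hw0 : 0 ≤ p * (‖w‖ ^ 4 / q ^ 3) := by positivity
  have hv0 : 0 ≤ p * P ^ 2 * q := by positivity
  rw [e5]
  linarith

/-- Young's inequality, interpolating `p ^ b * q` between `p ^ (3 * k + 6) * q ^ 3`, `p` and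
`p * q`. -/
lemma rpow_mul_le_of_interpolation {p q T l k b θ : ℝ} (hp : 0 < p) (hq : 0 < q) (hT : 0 < T)
    (hl : 0 < l) (hθ0 : 0 ≤ θ) (hθ1 : 3 * θ < 1) (hb : θ * (3 * k + 5) = b - 1) :
    p ^ b * q ≤ l * (p ^ (3 * k + 6) * q ^ 3 / T ^ 2 + T * p) +
      l ^ (-(3 * θ) / (1 - 3 * θ)) * (p * q) := by
  -- Logarithmic variables turn the matching of exponents into linear algebra.
  obtain ⟨P, rfl⟩ : ∃ P, Real.exp P = p := ⟨_, Real.exp_log hp⟩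
  obtain ⟨Q, rfl⟩ : ∃ P, Real.exp P = q := ⟨_, Real.exp_log hq⟩
  obtain ⟨t, rfl⟩ : ∃ P, Real.exp P = T := ⟨_, Real.exp_log hT⟩
  obtain ⟨s, rfl⟩ : ∃ P, Real.exp P = l := ⟨_, Real.exp_log hl⟩
  have h13 : 0 < 1 - 3 * θ := by linarith
  simp only [← Real.exp_mul, ← Real.exp_nat_mul, ← Real.exp_add, ← Real.exp_sub, mul_add (Real.exp s)]
  -- With weights `θ`, `2θ`, `1 - 3θ`, the powers of `T` and of `l` cancel in the geometric mean.
  have key := Real.geom_mean_le_arith_mean3_weighted hθ0 (by linarith : 0 ≤ 2 * θ) h13.le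
    (Real.exp_pos (s + (P * (3 * k + 6) + 3 * Q - 2 * t))).le (Real.exp_pos (s + (t + P))).le
    (Real.exp_pos (s * (-(3 * θ) / (1 - 3 * θ)) + (P + Q))).le (by ring)
  simp only [← Real.exp_mul, ← Real.exp_add] at key
  have e : (s + (P * (3 * k + 6) + 3 * Q - 2 * t)) * θ + (s + (t + P)) * (2 * θ) +
      (s * (-(3 * θ) / (1 - 3 * θ)) + (P + Q)) * (1 - 3 * θ) = P * b + Q := by
    have : b = θ * (3 * k + 5) + 1 := by linarith
    rw [this]
    field_simp
    ring
  rw [e] at key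
  push_cast
  refine key.trans (add_le_add (add_le_add ?_ ?_) ?_)
  · exact mul_le_of_le_one_left (Real.exp_pos _).le (by linarith)
  · exact mul_le_of_le_one_left (Real.exp_pos _).le (by linarith)
  · exact mul_le_of_le_one_left (Real.exp_pos _).le (by linarith)

/-! ### Absorption and conclusion -/

theorem lemma3p5 (Ω : Set (EuclideanSpace ℝ (Fin 3))) (hΩ : IsSmoothlyBoundedDomain Ω)
    (L k β : ℝ) (hL : 0 < L) (hk : k ∈ Set.Ioo (-1 : ℝ) (-(1 / 3)))
    (hβ : β ∈ Set.Ico (1 : ℝ) (k + 8 / 3)) :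
    ∃ C : ℝ, 0 < C ∧
      ∀ φ ψ : EuclideanSpace ℝ (Fin 3) → ℝ,
        IsC1UpToBoundary Ω φ → IsC1UpToBoundary Ω ψ →
        (∀ x ∈ closure Ω, 0 < φ x) → (∀ x ∈ closure Ω, 0 < ψ x) →
        (∫ x in Ω, φ x) ≤ L →
        (∫ x in Ω, φ x ^ β * ψ x) ≤
          (∫ x in Ω, φ x ^ k * ψ x * ‖∇ φ x‖ ^ 2) +
            (∫ x in Ω, φ x * (‖∇ ψ x‖ ^ 4 / ψ x ^ 3)) +
            C * ∫ x in Ω, φ x * ψ x := by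
  obtain ⟨S, hS, hSob⟩ := hΩ.exists_integral_pow_six_le
  obtain ⟨hk1, hk2⟩ := hk
  -- Raising `β` to at least `2k + 3` lets `φ^b ψ + φψ` dominate the leftover `φ^(2k+3) ψ`; `k <
  -- -1/3` keeps `2k + 3` below `k + 8/3`.
  obtain ⟨b, hb1, hbβ, hbk, hb8⟩ : ∃ b : ℝ, 1 ≤ b ∧ β ≤ b ∧ 2 * k + 3 ≤ b ∧ b < k + 8 / 3 :=
    ⟨max β (2 * k + 3), hβ.1.trans (le_max_left _ _), le_max_left _ _, le_max_right _ _,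
      max_lt hβ.2 (by linarith)⟩
  have h35 : 0 < 3 * k + 5 := by linarith
  obtain ⟨θ, hθ⟩ : ∃ θ, θ = (b - 1) / (3 * k + 5) := ⟨_, rfl⟩
  have hθ0 : 0 ≤ θ := hθ ▸ div_nonneg (by linarith) h35.le
  have hθb : θ * (3 * k + 5) = b - 1 := by rw [hθ, div_mul_cancel₀ _ h35.ne']
  have hθ1 : 3 * θ < 1 := by
    rw [hθ, mul_div_assoc', div_lt_one h35]
    linarith
  -- With `1/4`, the term `2I` in `T / S` contributes only `I / 2` to the bound of `I` below.
  obtain ⟨l, hl0, hl⟩ : ∃ l : ℝ, 0 < l ∧ l * ((1 + L) * S) = 1 / 4 :=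
    ⟨1 / 4 / ((1 + L) * S), by positivity, div_mul_cancel₀ _ (by positivity)⟩
  set c := l ^ (-(3 * θ) / (1 - 3 * θ)) with hc
  have hc0 : 0 < c := Real.rpow_pos_of_pos hl0 _
  refine ⟨2 * c + 2, by positivity, fun φ ψ hφ hψ hφ0 hψ0 hφL => ?_⟩
  obtain ⟨hwC1, hwgrad⟩ := hφ.rpow_mul_rpow hΩ.isOpen hψ hφ0 hψ0 ((k + 2) / 2) (1 / 2)
  have hw6 := hSob _ hwC1
  obtain ⟨hφc, hφd, G, hGc, hG⟩ := hφ
  obtain ⟨hψc, hψd, D, hDc, hD⟩ := hψ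
  have hm := hΩ.isOpen.measurableSet
  have hrφ : ∀ c : ℝ, ContinuousOn (fun x => φ x ^ c) (closure Ω) := fun c =>
    hφc.rpow_const fun x hx => Or.inl (hφ0 x hx).ne'
  have int : ∀ {f : EuclideanSpace ℝ (Fin 3) → ℝ}, ContinuousOn f (closure Ω) →
      IntegrableOn f Ω := fun hf => hf.integrableOn_of_isBounded hΩ.isBounded
  have iφ : IntegrableOn φ Ω := int hφc
  have iM : IntegrableOn (fun x => φ x * ψ x) Ω := int (hφc.mul hψc)
  have iI : IntegrableOn (fun x => φ x ^ b * ψ x) Ω := int ((hrφ b).mul hψc)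
  have iβ : IntegrableOn (fun x => φ x ^ β * ψ x) Ω := int ((hrφ β).mul hψc)
  have i6 : IntegrableOn (fun x => φ x ^ (3 * k + 6) * ψ x ^ 3) Ω :=
    int ((hrφ _).mul (hψc.pow 3))
  have iA : IntegrableOn (fun x => φ x ^ k * ψ x * ‖∇ φ x‖ ^ 2) Ω := by
    refine IntegrableOn.congr_fun (int (((hrφ k).mul hψc).mul (hGc.norm.pow 2))) ?_ hm
    intro x hx
    simp only [hG x hx]
    rfl
  have iB : IntegrableOn (fun x => φ x * (‖∇ ψ x‖ ^ 4 / ψ x ^ 3)) Ω := by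
    refine IntegrableOn.congr_fun (int (hφc.mul ((hDc.norm.pow 4).div (hψc.pow 3)
      fun x hx => pow_ne_zero 3 (hψ0 x hx).ne'))) ?_ hm
    intro x hx
    simp only [hD x hx]
    rfl
  set w := fun x => φ x ^ ((k + 2) / 2) * ψ x ^ (1 / 2 : ℝ) with hw
  have iw : IntegrableOn (fun x => ‖∇ w x‖ ^ 2 + w x ^ 2) Ω := by
    obtain ⟨hwc, -, W, hWc, hW⟩ := hwC1
    refine IntegrableOn.congr_fun (int ((hWc.norm.pow 2).add (hwc.pow 2))) ?_ hm
    intro x hx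
    simp only [hW x hx]
    rfl
  set A := ∫ x in Ω, φ x ^ k * ψ x * ‖∇ φ x‖ ^ 2 with hA
  set B := ∫ x in Ω, φ x * (‖∇ ψ x‖ ^ 4 / ψ x ^ 3) with hB
  set M := ∫ x in Ω, φ x * ψ x with hM
  set I := ∫ x in Ω, φ x ^ b * ψ x with hI
  have hφΩ : ∀ x ∈ Ω, 0 < φ x := fun x hx => hφ0 x (subset_closure hx)
  have hψΩ : ∀ x ∈ Ω, 0 < ψ x := fun x hx => hψ0 x (subset_closure hx)
  have hA0 : 0 ≤ A := setIntegral_nonneg hm fun x hx => by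
    have := hφΩ x hx
    have := hψΩ x hx
    positivity
  have hB0 : 0 ≤ B := setIntegral_nonneg hm fun x hx => by
    have := hφΩ x hx
    have := hψΩ x hx
    positivity
  have hI0 : 0 ≤ I := setIntegral_nonneg hm fun x hx => by
    have := hφΩ x hx
    have := hψΩ x hx
    positivity
  -- Strict positivity, from `Ω` being open and nonempty, makes `T > 0`, so that dividing by `T²` is
  -- legitimate.
  have hM0 : 0 < M := by
    rw [hM, setIntegral_pos_iff_support_of_nonneg_ae
      ((ae_restrict_iff' hm).2 (ae_of_all _ fun x hx => (mul_pos (hφΩ x hx) (hψΩ x hx)).le)) iM]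
    refine (hΩ.isOpen.measure_pos volume hΩ.isConnected.nonempty).trans_le (measure_mono ?_)
    exact fun x hx => ⟨(mul_pos (hφΩ x hx) (hψΩ x hx)).ne', hx⟩
  have hpow : ∀ x ∈ Ω, ∀ n : ℕ, w x ^ n = φ x ^ ((k + 2) / 2 * n) * ψ x ^ ((1 / 2 : ℝ) * n) := by
    intro x hx n
    simp only [hw]
    rw [mul_pow, Real.rpow_mul_natCast (hφΩ x hx).le, Real.rpow_mul_natCast (hψΩ x hx).le]
  have hw2 : ∀ x ∈ Ω, w x ^ 2 = φ x ^ (k + 2) * ψ x := by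
    intro x hx
    rw [hpow x hx]
    norm_num
  have hw6' : ∀ x ∈ Ω, w x ^ 6 = φ x ^ (3 * k + 6) * ψ x ^ 3 := by
    intro x hx
    rw [hpow x hx, ← Real.rpow_natCast (ψ x)]
    congr 2
    · push_cast
      ring
    · norm_num
  set T := S * (2 * A + B + 2 * I + 2 * M) with hT
  have hT0 : 0 < T := by positivity
  have hH : ∫ x in Ω, (‖∇ w x‖ ^ 2 + w x ^ 2) ≤ 2 * A + B + 2 * I + 2 * M := by
    have hle : ∫ x in Ω, (‖∇ w x‖ ^ 2 + w x ^ 2) ≤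
        ∫ x in Ω, (2 * (φ x ^ k * ψ x * ‖∇ φ x‖ ^ 2) + φ x * (‖∇ ψ x‖ ^ 4 / ψ x ^ 3) +
          2 * (φ x ^ b * ψ x) + 2 * (φ x * ψ x)) := by
      refine setIntegral_mono_on iw (((iA.const_mul 2).add iB).add (iI.const_mul 2) |>.add
        (iM.const_mul 2)) hm fun x hx => ?_
      have hp := hφΩ x hx
      have hq := hψΩ x hx
      have h1 := sq_norm_smul_add_smul_le hp hq ⟨hk1, hk2⟩ (∇ φ x) (∇ ψ x)
      rw [← hwgrad x hx] at h1
      have h2 := mul_le_mul_of_nonneg_right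
        (rpow_le_rpow_add_self hp (by linarith : 1 ≤ 2 * k + 3) hbk) hq.le
      have h3 := mul_le_mul_of_nonneg_right
        (rpow_le_rpow_add_self hp (by linarith : 1 ≤ k + 2) (by linarith : k + 2 ≤ b)) hq.le
      have h4 : 0 < φ x ^ b * ψ x := by positivity
      have h5 : 0 < φ x * ψ x := by positivity
      rw [hw2 x hx]
      linarith
    refine hle.trans (le_of_eq ?_)
    have i1 : IntegrableOn (fun x => 2 * (φ x ^ k * ψ x * ‖∇ φ x‖ ^ 2) +
        φ x * (‖∇ ψ x‖ ^ 4 / ψ x ^ 3)) Ω := (iA.const_mul 2).add iB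
    have i2 : IntegrableOn (fun x => 2 * (φ x ^ k * ψ x * ‖∇ φ x‖ ^ 2) +
        φ x * (‖∇ ψ x‖ ^ 4 / ψ x ^ 3) + 2 * (φ x ^ b * ψ x)) Ω := i1.add (iI.const_mul 2)
    rw [integral_add i2 (iM.const_mul 2), integral_add i1 (iI.const_mul 2),
      integral_add (iA.const_mul 2) iB, integral_const_mul, integral_const_mul,
      integral_const_mul]
  have h6T : ∫ x in Ω, φ x ^ (3 * k + 6) * ψ x ^ 3 ≤ T ^ 3 := by
    rw [← setIntegral_congr_fun hm hw6']
    refine hw6.trans (pow_le_pow_left₀ ?_ (mul_le_mul_of_nonneg_left hH hS.le) 3)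
    exact mul_nonneg hS.le (integral_nonneg fun x => by positivity)
  have hIle : I ≤ l * (T + T * L) + c * M := by
    have i1 : IntegrableOn (fun x => l * ((φ x ^ (3 * k + 6) * ψ x ^ 3) / T ^ 2 + T * φ x)) Ω :=
      ((i6.div_const _).add (iφ.const_mul T)).const_mul l
    have hle : I ≤ ∫ x in Ω, (l * ((φ x ^ (3 * k + 6) * ψ x ^ 3) / T ^ 2 + T * φ x) +
        c * (φ x * ψ x)) :=
      setIntegral_mono_on iI (i1.add (iM.const_mul c)) hm fun x hx =>
          rpow_mul_le_of_interpolation (hφΩ x hx) (hψΩ x hx) hT0 hl0 hθ0 hθ1 hθb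
    refine hle.trans ?_
    rw [integral_add i1 (iM.const_mul c),
      integral_const_mul, integral_add (i6.div_const _) (iφ.const_mul T), integral_div,
      integral_const_mul, integral_const_mul]
    have : (∫ x in Ω, φ x ^ (3 * k + 6) * ψ x ^ 3) / T ^ 2 ≤ T := by
      rw [div_le_iff₀ (by positivity)]
      linarith
    gcongr
  have hlT : l * (T + T * L) = 1 / 4 * (2 * A + B + 2 * I + 2 * M) := by
    rw [← hl, hT]
    ring
  have hβI : ∫ x in Ω, φ x ^ β * ψ x ≤ I + M := by
    rw [hI, hM, ← integral_add iI iM]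
    refine setIntegral_mono_on iβ (iI.add iM) hm fun x hx => ?_
    rw [← add_mul]
    exact mul_le_mul_of_nonneg_right (rpow_le_rpow_add_self (hφΩ x hx) hβ.1 hbβ) (hψΩ x hx).le
  -- From `I ≤ (2A + B + 2I + 2M)/4 + cM` follows `I ≤ A + B/2 + (2c + 1)M`; the extra `M` from
  -- passing from `β` to `b` gives `2c + 2`.
  linarith

end
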